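/- Let $\mathfrak{c}=2^{\aleph_0}$, and let $\mathfrak{p}$ be the pseudointersection number: the least cardinality of a family $\mathcal{F}$ of subsets of $\omega$ such that every finite subfamily of $\mathcal{F}$ has infinite intersection, but there is no infinite $A\subseteq\omega$ with $A\setminus B$ finite for all $B\in\mathcal{F}$. If $2^{\mathfrak{p}}>\mathfrak{c}$, then there is a compact Hausdorff space that is separable, sequentially compact (every sequence has a convergent subsequence) and of cardinality $>\mathfrak{c}$. In particular, such a space exists if $\mathfrak{p}=\mathfrak{c}$, and hence also if Martin's Axiom holds (for every nonempty partial order $P$ all of whose antichains, i.e. sets of pairwise incompatible elements, are countable, and every family of fewer than $\mathfrak{c}$ dense subsets of $P$, there is a filter on $P$ that meets every member of the family). -/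

import Mathlib

/-- A family of subsets of `ℕ` is centered if every finite subfamily has infinite intersection. -/
def IsCenteredFamily (F : Set (Set ℕ)) : Prop :=
  ∀ G : Set (Set ℕ), G ⊆ F → G.Finite → (⋂₀ G).Infinite

/-- `A` is an infinite pseudointersection of `F`: `A` is infinite and `A ⊆* B` for all `B ∈ F`. -/
def IsInfinitePseudointersection (A : Set ℕ) (F : Set (Set ℕ)) : Prop :=
  A.Infinite ∧ ∀ B ∈ F, (A \ B).Finite

/-- The cardinalities of the centered families with no infinite pseudointersection. -/
def pseudointersectionCardinals : Set Cardinal.{0} :=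
  {κ | ∃ F : Set (Set ℕ), IsCenteredFamily F ∧
    (¬ ∃ A : Set ℕ, IsInfinitePseudointersection A F) ∧ Cardinal.mk F = κ}

/-- The pseudointersection number `𝔭`. -/
noncomputable def pseudointersectionNumber : Cardinal.{0} :=
  sInf pseudointersectionCardinals

/-- The minimum defining `𝔭` is taken over a nonempty set (a free ultrafilter is a witness). -/
theorem pseudointersectionCardinals_nonempty : pseudointersectionCardinals.Nonempty := by
  let U : Ultrafilter ℕ := Filter.hyperfilter ℕ
  refine ⟨_, {B | B ∈ U}, ?_, ?_, rfl⟩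
  · intro G hG hfin hcon
    exact Filter.notMem_hyperfilter_of_finite hcon ((Filter.sInter_mem hfin).2 hG)
  · rintro ⟨A, hA, hAB⟩
    obtain ⟨B, hBA, C, hCA, hBC⟩ : ∃ B : Set ℕ, (A ∩ B).Infinite ∧ ∃ C : Set ℕ,
        (A ∩ C).Infinite ∧ Bᶜ = C := by
      have := hA.to_subtype
      let f : ℕ → ℕ := fun n => (Nat.Subtype.orderIsoOfNat A n : ℕ)
      have hf : Function.Injective f :=
        Subtype.val_injective.comp (Nat.Subtype.orderIsoOfNat A).injective
      have hfA : ∀ n, f n ∈ A := fun n => (Nat.Subtype.orderIsoOfNat A n).2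
      refine ⟨Set.range fun n => f (2 * n), ?_, _, ?_, rfl⟩
      · refine Set.infinite_of_injective_forall_mem (f := fun n => f (2 * n))
          (fun a b h => by have := hf h; omega) (fun n => ⟨hfA _, n, rfl⟩)
      · refine Set.infinite_of_injective_forall_mem (f := fun n => f (2 * n + 1))
          (fun a b h => by have := hf h; omega) (fun n => ⟨hfA _, ?_⟩)
        rintro ⟨m, hm⟩
        have := hf hm
        omega
    subst hBC
    rcases U.mem_or_compl_mem B with h | h
    · exact hCA ((hAB B h).subset fun x hx => ⟨hx.1, hx.2⟩)
    · exact hBA ((hAB _ h).subset fun x hx => ⟨hx.1, fun h' => h' hx.2⟩)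

/-- The countable chain condition for a partial order used as a forcing notion: every family of
pairwise incompatible elements (no two of them have a common lower bound) is countable. -/
def ForcingCCC (P : Type) [PartialOrder P] : Prop :=
  ∀ A : Set P, IsStrongAntichain (· ≥ ·) A → A.Countable

/-- `D` is dense in the forcing sense: every element has an extension in `D`. -/
def ForcingDense {P : Type} [PartialOrder P] (D : Set P) : Prop :=
  ∀ p : P, ∃ d ∈ D, d ≤ p

/-- Martin's Axiom. -/
def MartinsAxiom : Prop :=
  ∀ (P : Type) [PartialOrder P] [Nonempty P], ForcingCCC P →
    ∀ 𝒟 : Set (Set P), Cardinal.mk 𝒟 < Cardinal.continuum → (∀ D ∈ 𝒟, ForcingDense D) →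
      ∃ G : Order.PFilter P, ∀ D ∈ 𝒟, ((G : Set P) ∩ D).Nonempty

/-! Let κ be the least cardinal with 2^κ > 𝔠. Then ω < κ ≤ 𝔠 and κ ≤ 𝔭, and countable subsets of κ
are bounded. If no family of κ sets is splitting (every such family fails to split some infinite
set), the power of `Bool` with κ factors is sequentially compact. It is separable because κ ≤ 𝔠, and
it has 2^κ points.

Otherwise a splitting family (S_a), a < κ, steers a binary tree of height κ of infinite subsets of
ℕ, decreasing modulo finite sets (`exists_isSplittingTree`). Pseudointersections continue the tree
at every level because κ ≤ 𝔭. The space is the closure of the traces of ℕ on the nodes. It is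
separable by construction, and the 2^κ full branches give distinct points (`mk_le`).

Sequential compactness has two halves. Points of the remainder are coded by possibly terminating
branches. A lexicographically monotone subsequence converges, since the cylinders are convex. For
sequences from ℕ, every infinite set must have an infinite subset split by no node (`not_isWild`). A
counterexample B would carry a Cantor scheme of subsets, hence 𝔠 branches of one bounded length. The
construction has reserved, below some branch of that length, an infinite subset of B disjoint from
all further nodes. No node splits that subset. -/

open Cardinal Set Filter Topology

/-! ### Transfinite recursion and injective choice. -/

/-- Recursion along a well-order where each value is chosen subject to a requirement on the
earlier ones. -/
theorem exists_forall_of_wellFoundedLT {I X : Type*} [LinearOrder I] [WellFoundedLT I] [Nonempty X]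
    (R : I → (I → X) → X → Prop)
    (hR : ∀ a G G' y, (∀ b < a, G b = G' b) → R a G y → R a G' y)
    (h : ∀ a G, (∀ b < a, R b G (G b)) → ∃ y, R a G y) :
    ∃ G : I → X, ∀ a, R a G (G a) := by
  classical
  let x₀ : X := Classical.arbitrary X
  let step : ∀ a : I, (∀ b, b < a → X) → X := fun a rec =>
    Classical.epsilon (R a (fun b => if hb : b < a then rec b hb else x₀))
  let G : I → X := (wellFounded_lt (α := I)).fix step
  have hG : ∀ a, G a = step a (fun b _ => G b) := fun a =>
    (wellFounded_lt (α := I)).fix_eq step a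
  refine ⟨G, fun a => ?_⟩
  induction a using WellFoundedLT.induction with
  | ind a ih =>
    obtain ⟨y, hy⟩ := h a G ih
    have h1 : R a (fun b => if hb : b < a then G b else x₀) y :=
      hR a G _ y (fun b hb => by simp [hb]) hy
    have h2 : R a (fun b => if hb : b < a then G b else x₀) (G a) := by
      rw [hG a]
      exact Classical.epsilon_spec (p := R a (fun b => if hb : b < a then G b else x₀)) ⟨y, h1⟩
    exact hR a _ G _ (fun b hb => by simp [hb]) h2

/-- Sets each containing at least `κ` points admit an injective choice function, if there are at
most `κ` of them. -/
theorem exists_injective_forall_mem {T Z : Type} (N : T → Set Z)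
    (hN : ∀ t, #T ≤ #(N t)) : ∃ h : T → Z, Function.Injective h ∧ ∀ t, h t ∈ N t := by
  obtain ⟨e⟩ : Nonempty (T ≃ (#T).ord.ToType) := by
    rw [← Cardinal.eq]; simp
  rcases isEmpty_or_nonempty T with hT | ⟨⟨t₀⟩⟩
  · exact ⟨fun t => (hT.false t).elim, fun t => (hT.false t).elim, fun t => (hT.false t).elim⟩
  have : Nonempty Z := by
    have h0 : #T ≠ 0 := Cardinal.mk_ne_zero_iff.2 ⟨t₀⟩
    by_contra hZ
    rw [not_nonempty_iff] at hZ
    have := hN t₀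
    rw [Cardinal.mk_eq_zero (N t₀)] at this
    exact h0 (le_antisymm this (zero_le))
  obtain ⟨G, hG⟩ := exists_forall_of_wellFoundedLT (I := (#T).ord.ToType) (X := Z)
    (fun a G y => y ∈ N (e.symm a) ∧ ∀ b < a, y ≠ G b)
    (fun a G G' y hGG' hy => ⟨hy.1, fun b hb => hGG' b hb ▸ hy.2 b hb⟩)
    (fun a G _ => by
      by_contra hcon
      push Not at hcon
      -- If all of `N (e.symm a)` were used up, it would have at most as many points as a proper
      -- initial segment of an initial ordinal.
      have h1 : N (e.symm a) ⊆ G '' Iio a := fun y hy => by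
        obtain ⟨b, hb, hyb⟩ := hcon y hy
        exact ⟨b, hb, hyb.symm⟩
      have h2 : #(N (e.symm a)) < #T :=
        ((Cardinal.mk_le_mk_of_subset h1).trans Cardinal.mk_image_le).trans_lt
          (by simpa using Cardinal.mk_Iio_lt a (by simp))
      exact (hN _).not_gt h2)
  refine ⟨G ∘ e, fun s t hst => ?_, fun t => by simpa using (hG (e t)).1⟩
  rcases lt_trichotomy (e s) (e t) with h | h | h
  · exact absurd hst.symm ((hG (e t)).2 _ h)
  · exact e.injective h
  · exact absurd hst ((hG (e s)).2 _ h)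

/-! ### Almost inclusion and pseudointersections of chains. -/

/-- An infinite set of natural numbers splits into two infinite halves. -/
theorem Set.Infinite.exists_split {A : Set ℕ} (hA : A.Infinite) :
    ∃ B ⊆ A, ∃ C ⊆ A, B.Infinite ∧ C.Infinite ∧ Disjoint B C := by
  classical
  have := hA.to_subtype
  let f : ℕ → ℕ := fun n => (Nat.Subtype.orderIsoOfNat A n : ℕ)
  have hf : Function.Injective f :=
    Subtype.val_injective.comp (Nat.Subtype.orderIsoOfNat A).injective
  have hfA : ∀ n, f n ∈ A := fun n => (Nat.Subtype.orderIsoOfNat A n).2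
  refine ⟨range fun n => f (2 * n), ?_, range fun n => f (2 * n + 1), ?_, ?_, ?_, ?_⟩
  · rintro _ ⟨n, rfl⟩; exact hfA _
  · rintro _ ⟨n, rfl⟩; exact hfA _
  · exact infinite_range_of_injective fun a b h => by have := hf h; omega
  · exact infinite_range_of_injective fun a b h => by have := hf h; omega
  · rw [Set.disjoint_left]
    rintro _ ⟨n, rfl⟩ ⟨m, hm⟩
    have := hf hm
    omega

/-- If `A` is infinite and `A ⊆* B`, then `A ∩ B` is infinite. -/
theorem Set.Infinite.inter_of_diff_finite {A B : Set ℕ} (hA : A.Infinite) (h : (A \ B).Finite) :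
    (A ∩ B).Infinite := fun h' => hA (by
  rw [← inter_union_sdiff A B]; exact h'.union h)

theorem Set.Finite.diff_trans {A B C : Set ℕ} (h : (A \ B).Finite) (h' : (B \ C).Finite) :
    (A \ C).Finite :=
  (h.union h').subset fun x hx => by
    by_cases hB : x ∈ B
    · exact Or.inr ⟨hB, hx.2⟩
    · exact Or.inl ⟨hx.1, hB⟩

/-- An infinite set cannot be almost contained in two almost disjoint sets. -/
theorem Set.Infinite.not_finite_inter {A B C : Set ℕ} (hA : A.Infinite) (hB : (A \ B).Finite)
    (hC : (A \ C).Finite) : ¬ (B ∩ C).Finite := fun h =>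
  hA ((hB.union (hC.union h)).subset fun x hx => by
    by_cases h1 : x ∈ B
    · by_cases h2 : x ∈ C
      · exact Or.inr (Or.inr ⟨h1, h2⟩)
      · exact Or.inr (Or.inl ⟨hx, h2⟩)
    · exact Or.inl ⟨hx, h1⟩)

/-- Below `κ`, centered families have infinite pseudointersections. -/
def HasPseudointersectionsBelow (κ : Cardinal.{0}) : Prop :=
  ∀ F : Set (Set ℕ), IsCenteredFamily F → #F < κ → ∃ A, IsInfinitePseudointersection A F

theorem hasPseudointersectionsBelow_of_le {κ : Cardinal.{0}} (h : κ ≤ pseudointersectionNumber) :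
    HasPseudointersectionsBelow κ := fun F hF hκ => by
  by_contra hA
  exact (hκ.trans_le h).not_ge (csInf_le' ⟨F, hF, hA, rfl⟩)

/-- Almost decreasing families of infinite subsets of an infinite set `B`, indexed by `J`, have an
infinite pseudointersection inside `B`. -/
def HasChainPseudointersections (J : Type) [LinearOrder J] : Prop :=
  ∀ (B : Set ℕ) (G : J → Set ℕ), B.Infinite → (∀ j, (G j).Infinite) →
    (∀ j, (G j \ B).Finite) → (∀ i j, i ≤ j → (G j \ G i).Finite) →
    ∃ D ⊆ B, D.Infinite ∧ ∀ j, (D \ G j).Finite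

theorem HasPseudointersectionsBelow.hasChainPseudointersections {κ : Cardinal.{0}}
    (hκ : HasPseudointersectionsBelow κ) {J : Type} [LinearOrder J] (hJ : #J < κ) :
    HasChainPseudointersections J := by
  intro B G hB hG hGB hmono
  rcases isEmpty_or_nonempty J with hJ' | ⟨⟨j₀⟩⟩
  · exact ⟨B, Subset.rfl, hB, fun j => (hJ'.false j).elim⟩
  obtain ⟨D, hD, hDG⟩ := hκ (range G) (by
    intro F hF hfin
    -- A chain modulo finite sets is centered: each finite intersection almost contains a single
    -- term.
    have key : ∃ j, (G j \ ⋂₀ F).Finite := by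
      induction F, hfin using Set.Finite.induction_on with
      | empty => exact ⟨j₀, by simp⟩
      | @insert S F _ _ ih =>
        obtain ⟨j, hj⟩ := ih ((subset_insert _ _).trans hF)
        obtain ⟨i, rfl⟩ := hF (mem_insert _ _)
        refine ⟨max i j, ((hmono i _ (le_max_left i j)).union
          ((hmono j _ (le_max_right i j)).diff_trans hj)).subset ?_⟩
        rw [sInter_insert]
        rintro x ⟨hx, hx'⟩
        by_cases hi : x ∈ G i
        · exact Or.inr ⟨hx, fun h => hx' ⟨hi, h⟩⟩
        · exact Or.inl ⟨hx, hi⟩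
    obtain ⟨j, hj⟩ := key
    exact ((hG j).inter_of_diff_finite hj).mono inter_subset_right)
    (mk_range_le.trans_lt hJ)
  have h1 : (D \ B).Finite := (hDG _ ⟨j₀, rfl⟩).diff_trans (hGB j₀)
  exact ⟨D ∩ B, inter_subset_right, hD.inter_of_diff_finite h1,
    fun j => (hDG _ ⟨j, rfl⟩).subset (sdiff_subset_sdiff_left inter_subset_left)⟩

theorem IsInfinitePseudointersection.mono {A A' : Set ℕ} {F : Set (Set ℕ)}
    (h : IsInfinitePseudointersection A F) (hA' : A'.Infinite) (hsub : A' ⊆ A) :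
    IsInfinitePseudointersection A' F :=
  ⟨hA', fun E hE => (h.2 E hE).subset (sdiff_subset_sdiff_left hsub)⟩

/-! ### Construction of the splitting tree. -/

/-- Every infinite set contains two disjoint infinite sets on which `S` is constant. -/
theorem Set.Infinite.exists_split_unsplit {D : Set ℕ} (hD : D.Infinite) (S : Set ℕ) :
    ∃ A : Bool → Set ℕ, (∀ i, (A i).Infinite) ∧ (∀ i, A i ⊆ D) ∧ Disjoint (A true) (A false) ∧
      ∀ i, A i ⊆ S ∨ Disjoint (A i) S := by
  obtain ⟨D', hD', hD'D, hS⟩ : ∃ D' : Set ℕ, D'.Infinite ∧ D' ⊆ D ∧ (D' ⊆ S ∨ Disjoint D' S) := by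
    by_cases h : (D ∩ S).Infinite
    · exact ⟨_, h, inter_subset_left, Or.inl inter_subset_right⟩
    · refine ⟨D \ S, fun h' => hD ?_, sdiff_subset, Or.inr disjoint_sdiff_left⟩
      rw [← inter_union_sdiff D S]
      exact (not_infinite.1 h).union h'
  obtain ⟨B, hB, C, hC, hBi, hCi, hBC⟩ := hD'.exists_split
  refine ⟨fun i => if i then B else C, ?_, ?_, by simpa using hBC, ?_⟩
  · rintro (_ | _) <;> simpa
  · rintro (_ | _)
    · simpa using hC.trans hD'D
    · simpa using hB.trans hD'D
  · rintro (_ | _)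
    · simpa using hS.imp hC.trans (·.mono_left hC)
    · simpa using hS.imp hB.trans (·.mono_left hB)

/-- Below pseudointersections of families `F z` one can choose two disjoint infinite sets not split
by `S`, which avoid a large part of every set `B` that contains pseudointersections of continuum
many of the families. -/
theorem exists_node_successors {Z : Type} (S : Set ℕ) (F : Z → Set (Set ℕ))
    (hF : ∀ z, ∃ D, IsInfinitePseudointersection D (F z)) :
    ∃ A : Z → Bool → Set ℕ, (∀ z i, IsInfinitePseudointersection (A z i) (F z)) ∧
      (∀ z, Disjoint (A z true) (A z false)) ∧ (∀ z i, A z i ⊆ S ∨ Disjoint (A z i) S) ∧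
      ∀ (B : Set ℕ) (Φ : (ℕ → Bool) → Z), Function.Injective Φ →
        (∀ x, ∃ C ⊆ B, IsInfinitePseudointersection C (F (Φ x))) →
        ∃ z, ∃ C ⊆ B, IsInfinitePseudointersection C (F z) ∧ ∀ i, Disjoint C (A z i) := by
  -- `T` collects the sets that have to be dealt with. There are at most 𝔠 of them and each offers 𝔠
  -- indices, so distinct sets can be served at distinct indices `h t`.
  let T := {B : Set ℕ // ∃ Φ : (ℕ → Bool) → Z, Function.Injective Φ ∧
    ∀ x, ∃ C ⊆ B, IsInfinitePseudointersection C (F (Φ x))}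
  choose Φ hΦ hΦB using fun t : T => t.2
  obtain ⟨h, hinj, hmem⟩ := exists_injective_forall_mem (fun t : T => range (Φ t)) (fun t => by
    rw [Cardinal.mk_range_eq _ (hΦ t)]
    exact (Cardinal.mk_subtype_le _).trans (by simp))
  have key : ∀ z, ∃ D, IsInfinitePseudointersection D (F z) ∧
      ∀ t, h t = z → ∃ C ⊆ t.1, IsInfinitePseudointersection C (F z) ∧ Disjoint C D := by
    intro z
    by_cases hz : ∃ t, h t = z
    · obtain ⟨t, rfl⟩ := hz
      obtain ⟨x, hx⟩ := hmem t
      obtain ⟨C, hCB, hC⟩ := hΦB t x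
      rw [hx] at hC
      -- One half of `C` will host both successors; the other stays in reserve, disjoint from them.
      obtain ⟨C₁, h₁, C₂, h₂, hi₁, hi₂, hd⟩ := hC.1.exists_split
      refine ⟨C₁, hC.mono hi₁ h₁, fun t' ht' => ?_⟩
      rw [hinj ht']
      exact ⟨C₂, h₂.trans hCB, hC.mono hi₂ h₂, hd.symm⟩
    · obtain ⟨D, hD⟩ := hF z
      exact ⟨D, hD, fun t ht => (hz ⟨t, ht⟩).elim⟩
  choose D hD hDkill using key
  choose A hA hAD hAdisj hAS using fun z => (hD z).1.exists_split_unsplit S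
  refine ⟨A, fun z i => (hD z).mono (hA z i) (hAD z i), hAdisj, hAS, fun B Ψ hΨ hB => ?_⟩
  let t : T := ⟨B, Ψ, hΨ, hB⟩
  obtain ⟨C, hCB, hC, hCD⟩ := hDkill (h t) t rfl
  exact ⟨h t, C, hCB, hC, fun i => hCD.mono_right (hAD (h t) i)⟩

/-- Extension by `false` of a partial branch of length `a`. -/
noncomputable def extendBranch {I : Type} [LinearOrder I] {a : I} (z : Iio a → Bool) : I → Bool :=
  fun b => if h : b < a then z ⟨b, h⟩ else false

theorem extendBranch_restrict {I : Type} [LinearOrder I] {a b : I} (f : I → Bool) (h : b < a) :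
    extendBranch ((Iio a).domRestrict f) b = f b := by
  simp [extendBranch, Set.domRestrict, h]

theorem restrict_extendBranch {I : Type} [LinearOrder I] {a : I} (z : Iio a → Bool) :
    (Iio a).domRestrict (extendBranch z) = z := by
  ext ⟨b, hb⟩
  simp [extendBranch, Set.domRestrict, mem_Iio.1 hb]

/-- `A a f` is the node at level `a` of the branch `f` in a tree of infinite sets of naturals which
decreases modulo finite sets, such that incompatible nodes are almost disjoint, the set `S a` does
not split the nodes of level `a`, and each set `B` that has continuum many branches of some
length `a` below it contains an infinite set below such a branch but disjoint from the nodes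
extending it. -/
structure IsSplittingTree {I : Type} [LinearOrder I] (S : I → Set ℕ) (A : I → (I → Bool) → Set ℕ) :
    Prop where
  congr : ∀ a f g, (∀ b ≤ a, f b = g b) → A a f = A a g
  infinite : ∀ a f, (A a f).Infinite
  diff_finite : ∀ a b f, b ≤ a → (A a f \ A b f).Finite
  disjoint : ∀ a f g, (∀ b < a, f b = g b) → f a ≠ g a → Disjoint (A a f) (A a g)
  unsplit : ∀ a f, A a f ⊆ S a ∨ Disjoint (A a f) (S a)
  kill : ∀ (a : I) (B : Set ℕ) (Φ : (ℕ → Bool) → I → Bool),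
    (∀ x y, (∀ b < a, Φ x b = Φ y b) → x = y) →
    (∀ x, ∃ C ⊆ B, C.Infinite ∧ ∀ b < a, (C \ A b (Φ x)).Finite) →
    ∃ f, ∃ C ⊆ B, C.Infinite ∧ (∀ b < a, (C \ A b f).Finite) ∧
      ∀ g, (∀ b < a, g b = f b) → Disjoint C (A a g)

/-- Recursion on levels: each branch of length `a` is a chain modulo finite sets, so it has a
pseudointersection, and `exists_node_successors` supplies all nodes of level `a` at once. Padding a
partial branch by `false` is harmless because nodes of level b depend only on coordinates up to b.
-/
theorem exists_isSplittingTree {I : Type} [LinearOrder I] [WellFoundedLT I]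
    (hI : ∀ a : I, HasChainPseudointersections (Iio a)) (S : I → Set ℕ) :
    ∃ A : I → (I → Bool) → Set ℕ, IsSplittingTree S A := by
  let F : ∀ a : I, (I → (I → Bool) → Set ℕ) → (Iio a → Bool) → Set (Set ℕ) := fun a A z =>
    (fun b => A b (extendBranch z)) '' Iio a
  let R : ∀ a : I, (I → (I → Bool) → Set ℕ) → ((I → Bool) → Set ℕ) → Prop := fun a A Y =>
    ∃ Y' : (Iio a → Bool) → Bool → Set ℕ, (∀ f, Y f = Y' ((Iio a).domRestrict f) (f a)) ∧
      (∀ z i, IsInfinitePseudointersection (Y' z i) (F a A z)) ∧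
      (∀ z, Disjoint (Y' z true) (Y' z false)) ∧
      (∀ z i, Y' z i ⊆ S a ∨ Disjoint (Y' z i) (S a)) ∧
      ∀ (B : Set ℕ) (Φ : (ℕ → Bool) → (Iio a → Bool)), Function.Injective Φ →
        (∀ x, ∃ C ⊆ B, IsInfinitePseudointersection C (F a A (Φ x))) →
        ∃ z, ∃ C ⊆ B, IsInfinitePseudointersection C (F a A z) ∧ ∀ i, Disjoint C (Y' z i)
  have hFcongr : ∀ a A A', (∀ b < a, A b = A' b) → F a A = F a A' := fun a A A' h => by
    funext z
    exact image_congr fun b hb => by rw [h b hb]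
  have hcongr : ∀ a A Y, R a A Y → ∀ f g, (∀ b ≤ a, f b = g b) → Y f = Y g := by
    rintro a A Y ⟨Y', hY, -⟩ f g hfg
    rw [hY, hY, hfg a le_rfl, show (Iio a).domRestrict f = (Iio a).domRestrict g from
      funext fun b => hfg b b.2.le]
  have hdiff : ∀ a A Y, R a A Y → ∀ b < a, (∀ f g, (∀ c ≤ b, f c = g c) → A b f = A b g) →
      ∀ f, (Y f \ A b f).Finite := by
    rintro a A Y ⟨Y', hY, hps, -⟩ b hb hA f
    rw [hY, hA f (extendBranch ((Iio a).domRestrict f)) fun c hc =>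
      (extendBranch_restrict f (hc.trans_lt hb)).symm]
    exact (hps _ _).2 _ ⟨b, hb, rfl⟩
  obtain ⟨A, hA⟩ := exists_forall_of_wellFoundedLT R
    (fun a A A' Y h hY => by
      simp only [R, ← hFcongr a A A' h]
      exact hY)
    (fun a A hA => by
      obtain ⟨Y', h⟩ := exists_node_successors (S a) (F a A) (fun z => by
        obtain ⟨D, -, hD, hDA⟩ := hI a univ (fun b => A b (extendBranch z)) infinite_univ
          (fun b => by
            obtain ⟨Y', hY, hps, -⟩ := hA b b.2
            rw [hY]
            exact (hps _ _).1) (fun b => by simp)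
          (fun b c hbc => by
            rcases hbc.eq_or_lt with rfl | hbc
            · simp
            · exact hdiff c A _ (hA c c.2) b hbc (hcongr b A _ (hA b b.2)) _)
        refine ⟨D, hD, ?_⟩
        rintro _ ⟨b, hb, rfl⟩
        exact hDA ⟨b, hb⟩)
      exact ⟨fun f => Y' ((Iio a).domRestrict f) (f a), Y', fun _ => rfl, h⟩)
  have hAcongr : ∀ a f g, (∀ b ≤ a, f b = g b) → A a f = A a g := fun a => hcongr a A _ (hA a)
  have hps : ∀ (a : I) (z : Iio a → Bool) (C : Set ℕ), IsInfinitePseudointersection C (F a A z) ↔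
      C.Infinite ∧ ∀ b < a, (C \ A b (extendBranch z)).Finite := fun a z C => by
    simp [IsInfinitePseudointersection, F]
  refine ⟨A, hAcongr, fun a f => ?_, fun a b f hb => ?_, fun a f g h hne => ?_, fun a f => ?_,
    fun a B Φ hΦ hB => ?_⟩
  · obtain ⟨Y', hY, hps, -⟩ := hA a
    rw [hY]
    exact (hps _ _).1
  · rcases hb.eq_or_lt with rfl | hb
    · simp
    · exact hdiff a A _ (hA a) b hb (hAcongr b) f
  · obtain ⟨Y', hY, -, hd, -⟩ := hA a
    rw [hY, hY, show (Iio a).domRestrict f = (Iio a).domRestrict g from funext fun b => h b b.2]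
    cases hf : f a <;> cases hg : g a
    · exact (hne (hf.trans hg.symm)).elim
    · exact (hd _).symm
    · exact hd _
    · exact (hne (hf.trans hg.symm)).elim
  · obtain ⟨Y', hY, -, -, hS, -⟩ := hA a
    rw [hY]
    exact hS _ _
  · obtain ⟨Y', hY, -, -, -, hkill⟩ := hA a
    obtain ⟨z, C, hCB, hC, hCY⟩ := hkill B (fun x => (Iio a).domRestrict (Φ x))
      (fun x y hxy => hΦ x y fun b hb => congrFun hxy ⟨b, hb⟩) (fun x => by
        obtain ⟨C, hCB, hC, hCA⟩ := hB x
        refine ⟨C, hCB, (hps _ _ _).2 ⟨hC, fun b hb => ?_⟩⟩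
        rw [hAcongr b _ (Φ x) fun c hc => extendBranch_restrict _ (hc.trans_lt hb)]
        exact hCA b hb)
    refine ⟨extendBranch z, C, hCB, hC.1, ((hps _ _ _).1 hC).2, fun g hg => ?_⟩
    rw [hY, show (Iio a).domRestrict g = z by
      rw [← restrict_extendBranch z]
      exact funext fun b => hg b b.2]
    exact hCY _

/-! ### Wild sets and why they do not exist. -/

/-- Every infinite subset of `B` is split by some node of the tree `A`. -/
def IsWild {I : Type} (A : I → (I → Bool) → Set ℕ) (B : Set ℕ) : Prop :=
  B.Infinite ∧ ∀ C ⊆ B, C.Infinite → ∃ a f, (C ∩ A a f).Infinite ∧ (C \ A a f).Infinite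

theorem IsWild.mono {I : Type} {A : I → (I → Bool) → Set ℕ} {B C : Set ℕ} (hB : IsWild A B)
    (hCB : C ⊆ B) (hC : C.Infinite) : IsWild A C :=
  ⟨hC, fun D hD => hB.2 D (hD.trans hCB)⟩

namespace IsSplittingTree

variable {I : Type} [LinearOrder I] {S : I → Set ℕ} {A : I → (I → Bool) → Set ℕ}

theorem inter_infinite_of_le (hA : IsSplittingTree S A) {a b : I} {f : I → Bool} {C : Set ℕ}
    (hb : b ≤ a) (h : (C ∩ A a f).Infinite) : (C ∩ A b f).Infinite := fun hfin =>
  h ((hfin.union (hA.diff_finite a b f hb)).subset fun x hx => by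
    by_cases hx' : x ∈ A b f
    · exact Or.inl ⟨hx.1, hx'⟩
    · exact Or.inr ⟨hx.2, hx'⟩)

variable [WellFoundedLT I]

/-- Compare both nodes with their predecessors at the first level where the branches differ, which
are disjoint. -/
theorem inter_finite (hA : IsSplittingTree S A) {a a' b : I} {f g : I → Bool} (hb : b ≤ a)
    (hb' : b ≤ a') (hfg : f b ≠ g b) : (A a f ∩ A a' g).Finite := by
  obtain ⟨c, hc, hmin⟩ := WellFounded.has_min (wellFounded_lt (α := I)) {c | f c ≠ g c} ⟨b, hfg⟩
  have hcb : c ≤ b := le_of_not_gt (hmin b hfg)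
  have hd := hA.disjoint c f g (fun d hd => by_contra fun h => hmin d h hd) hc
  refine ((hA.diff_finite a c f (hcb.trans hb)).union
    (hA.diff_finite a' c g (hcb.trans hb'))).subset fun x hx => ?_
  by_cases h : x ∈ A c f
  · exact Or.inr ⟨hx.2, fun h' => Set.disjoint_left.1 hd h h'⟩
  · exact Or.inl ⟨hx.1, h⟩

theorem eq_of_inter_infinite (hA : IsSplittingTree S A) {a b : I} {f g : I → Bool} (hb : b ≤ a)
    (h : (A a f ∩ A b g).Infinite) : A b f = A b g :=
  hA.congr b f g fun _ hc => by_contra fun hne => h (hA.inter_finite (hc.trans hb) hc hne)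

/-- A set below a branch of length `a` is not split by nodes of level less than `a`. -/
theorem not_split_of_lt (hA : IsSplittingTree S A) {a b : I} {f : I → Bool} {C : Set ℕ}
    (hC : ∀ b < a, (C \ A b f).Finite) (hb : b < a) (g : I → Bool) (h : (C ∩ A b g).Infinite) :
    (C \ A b g).Finite := by
  have : (A b f ∩ A b g).Infinite := fun hfin => h (((hC b hb).union hfin).subset fun x hx => by
    by_cases hx' : x ∈ A b f
    · exact Or.inr ⟨hx', hx.2⟩
    · exact Or.inl ⟨hx.1, hx'⟩)
  rw [← hA.eq_of_inter_infinite le_rfl this]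
  exact hC b hb

/-- Shrink `B` along the levels below `a`, entering one node at each, and take a pseudointersection
`D`. The nodes cohere into one branch because the infinite set `D` is almost contained in all of
them. -/
theorem exists_branch_aux (hA : IsSplittingTree S A)
    (hI : ∀ a : I, HasChainPseudointersections (Iio a)) (a : I)
    (ih : ∀ b < a, ∀ B, IsWild A B → ∃ f, (B ∩ A b f).Infinite) {B : Set ℕ} (hB : IsWild A B) :
    ∃ C ⊆ B, C.Infinite ∧ ∃ f, ∀ b < a, (C \ A b f).Finite := by
  obtain ⟨G, hG⟩ := exists_forall_of_wellFoundedLT (I := I) (X := Set ℕ)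
    (fun b G y => b < a → (∀ c < b, (y \ G c).Finite) ∧ y.Infinite ∧ y ⊆ B ∧ ∃ f, y ⊆ A b f)
    (fun b G G' y h hy hb => by
      refine ⟨fun c hc => ?_, (hy hb).2⟩
      rw [← h c hc]
      exact (hy hb).1 c hc)
    (fun b G hG => by
      by_cases hb : b < a
      · obtain ⟨D, hDB, hD, hDG⟩ := hI b B (fun c => G c) hB.1
          (fun c => (hG c c.2 (lt_trans c.2 hb)).2.1)
          (fun c => by
            rw [sdiff_eq_empty.2 (hG c c.2 (lt_trans c.2 hb)).2.2.1]
            exact finite_empty)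
          (fun c d hcd => by
            rcases hcd.eq_or_lt with rfl | hcd
            · simp
            · exact (hG d d.2 (lt_trans d.2 hb)).1 c hcd)
        obtain ⟨f, hf⟩ := ih b hb D (hB.mono hDB hD)
        exact ⟨D ∩ A b f, fun _ => ⟨fun c hc =>
          (hDG ⟨c, hc⟩).subset (sdiff_subset_sdiff_left inter_subset_left), hf,
          inter_subset_left.trans hDB, f, inter_subset_right⟩⟩
      · exact ⟨∅, fun h => (hb h).elim⟩)
  obtain ⟨D, hDB, hD, hDG⟩ := hI a B (fun c => G c) hB.1
    (fun c => (hG c c.2).2.1)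
    (fun c => by
      rw [sdiff_eq_empty.2 (hG c c.2).2.2.1]
      exact finite_empty)
    (fun c d hcd => by
      rcases hcd.eq_or_lt with rfl | hcd
      · simp
      · exact (hG d d.2).1 c hcd)
  have hex : ∀ b : I, ∃ f, b < a → G b ⊆ A b f := fun b => by
    by_cases hb : b < a
    · obtain ⟨f, hf⟩ := (hG b hb).2.2.2
      exact ⟨f, fun _ => hf⟩
    · exact ⟨fun _ => false, fun h => (hb h).elim⟩
  choose F hF using hex
  have hDF : ∀ b < a, (D \ A b (F b)).Finite := fun b hb =>
    (hDG ⟨b, hb⟩).subset (sdiff_subset_sdiff_right (hF b hb))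
  -- The diagonal of the chosen branches agrees with each `F b` up to level `b`: a disagreement
  -- would make two nodes above `D` almost disjoint.
  refine ⟨D, hDB, hD, fun b => F b b, fun b hb => ?_⟩
  rw [hA.congr b (fun b => F b b) (F b) fun c hc => ?_]
  · exact hDF b hb
  · by_contra hne
    exact hD.not_finite_inter (hDF c (hc.trans_lt hb)) (hDF b hb) (hA.inter_finite le_rfl hc hne)

theorem exists_inter_infinite (hA : IsSplittingTree S A)
    (hI : ∀ a : I, HasChainPseudointersections (Iio a)) (a : I) :
    ∀ B, IsWild A B → ∃ f, (B ∩ A a f).Infinite := by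
  induction a using WellFoundedLT.induction with
  | ind a ih =>
    intro B hB
    obtain ⟨C, hCB, hC, f, hf⟩ := hA.exists_branch_aux hI a ih hB
    obtain ⟨b, g, h1, h2⟩ := hB.2 C hCB hC
    -- Since `C` lies below a branch of length `a`, only a node of level at least `a` can split it;
    -- its predecessor at level `a` then meets `C` infinitely often.
    have hab : a ≤ b := le_of_not_gt fun hb => h2 (hA.not_split_of_lt hf hb g h1)
    exact ⟨g, (hA.inter_infinite_of_le hab h1).mono (inter_subset_inter_left _ hCB)⟩

theorem exists_branch (hA : IsSplittingTree S A)
    (hI : ∀ a : I, HasChainPseudointersections (Iio a)) (a : I) {B : Set ℕ} (hB : IsWild A B) :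
    ∃ C ⊆ B, C.Infinite ∧ ∃ f, ∀ b < a, (C \ A b f).Finite :=
  hA.exists_branch_aux hI a (fun b _ => hA.exists_inter_infinite hI b) hB

/-- Some `S a` cuts `B` into two wild pieces, each meeting a node of level `a`. As `S a` splits
neither node, one lies inside it and the other outside. -/
theorem exists_two_nodes (hA : IsSplittingTree S A)
    (hI : ∀ a : I, HasChainPseudointersections (Iio a))
    (hS : ∀ B : Set ℕ, B.Infinite → ∃ a, (B ∩ S a).Infinite ∧ (B \ S a).Infinite)
    {B : Set ℕ} (hB : IsWild A B) :
    ∃ (a : I) (f : Bool → I → Bool) (C : Bool → Set ℕ), (∀ i, C i ⊆ B) ∧ (∀ i, (C i).Infinite) ∧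
      (∀ i, C i ⊆ A a (f i)) ∧ ∀ i j, i ≠ j → Disjoint (A a (f i)) (A a (f j)) := by
  obtain ⟨a, h1, h0⟩ := hS B hB.1
  obtain ⟨f₁, hf₁⟩ := hA.exists_inter_infinite hI a _ (hB.mono inter_subset_left h1)
  obtain ⟨f₀, hf₀⟩ := hA.exists_inter_infinite hI a _ (hB.mono sdiff_subset h0)
  have hd : Disjoint (A a f₁) (A a f₀) := by
    rcases hA.unsplit a f₁ with h | h
    · rcases hA.unsplit a f₀ with h' | h'
      · obtain ⟨x, hx⟩ := hf₀.nonempty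
        exact (hx.1.2 (h' hx.2)).elim
      · exact (h'.mono_right h).symm
    · obtain ⟨x, hx⟩ := hf₁.nonempty
      exact (Set.disjoint_left.1 h hx.2 hx.1.2).elim
  refine ⟨a, fun i => if i then f₁ else f₀,
    fun i => if i then B ∩ S a ∩ A a f₁ else B \ S a ∩ A a f₀, ?_, ?_, ?_, ?_⟩
  · rintro (_ | _)
    · simpa using inter_subset_left.trans sdiff_subset
    · simpa using inter_subset_left.trans inter_subset_left
  · rintro (_ | _) <;> simpa
  · rintro (_ | _) <;> simp
  · rintro (_ | _) (_ | _) h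
    · exact (h rfl).elim
    · simpa using hd.symm
    · simpa using hd
    · exact (h rfl).elim

/-- The list of the first `n` values of `x`, the last value first. -/
def initialValues (x : ℕ → Bool) : ℕ → List Bool
  | 0 => []
  | n + 1 => x n :: initialValues x n

theorem initialValues_congr {x y : ℕ → Bool} {n : ℕ} (h : ∀ m < n, x m = y m) :
    initialValues x n = initialValues y n := by
  induction n with
  | zero => rfl
  | succ n ih =>
    rw [initialValues, initialValues, h n n.lt_succ_self, ih fun m hm => h m (hm.trans n.lt_succ_self)]

/-- A wild set has continuum many branches of some bounded length below it. -/
theorem exists_continuum_branches (hA : IsSplittingTree S A)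
    (hI : ∀ a : I, HasChainPseudointersections (Iio a)) (hω : HasChainPseudointersections ℕ)
    (hcof : ∀ s : Set I, s.Countable → ∃ a, ∀ b ∈ s, b < a)
    (hS : ∀ B : Set ℕ, B.Infinite → ∃ a, (B ∩ S a).Infinite ∧ (B \ S a).Infinite)
    {B : Set ℕ} (hB : IsWild A B) :
    ∃ (a : I) (Φ : (ℕ → Bool) → I → Bool), (∀ x y, (∀ b < a, Φ x b = Φ y b) → x = y) ∧
      ∀ x, ∃ C ⊆ B, C.Infinite ∧ ∀ b < a, (C \ A b (Φ x)).Finite := by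
  choose lev node next hnB hni hnA hnd using
    fun B : {B // IsWild A B} => hA.exists_two_nodes hI hS B.2
  -- A Cantor scheme of wild sets below `B`. It involves only countably many levels, so some `a`
  -- lies above them all.
  let T : List Bool → {B // IsWild A B} := fun l =>
    l.rec ⟨B, hB⟩ fun i _ D => ⟨next D i, D.2.mono (hnB D i) (hni D i)⟩
  obtain ⟨a, ha⟩ := hcof (range fun l => lev (T l)) (countable_range _)
  have hanti : ∀ x, Antitone fun n => (T (initialValues x n)).1 := fun x =>
    antitone_nat_of_succ_le fun n => hnB _ _
  have key : ∀ x, ∃ C ⊆ B, C.Infinite ∧ (∀ n, (C \ (T (initialValues x n)).1).Finite) ∧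
      ∃ f, ∀ b < a, (C \ A b f).Finite := fun x => by
    obtain ⟨D, hDB, hD, hDT⟩ := hω B (fun n => (T (initialValues x n)).1) hB.1
      (fun n => (T _).2.1)
      (fun n => by
        have h : (T (initialValues x n)).1 ⊆ B := hanti x (Nat.zero_le n)
        rw [sdiff_eq_empty.2 h]
        exact finite_empty)
      (fun m n hmn => by
        have h : (T (initialValues x n)).1 ⊆ (T (initialValues x m)).1 := hanti x hmn
        rw [sdiff_eq_empty.2 h]
        exact finite_empty)
    obtain ⟨C, hCD, hC, f, hf⟩ := hA.exists_branch hI a (hB.mono hDB hD)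
    exact ⟨C, hCD.trans hDB, hC, fun n => (hDT n).subset (sdiff_subset_sdiff_left hCD), f, hf⟩
  choose C hCB hC hCT Φ hΦ using key
  refine ⟨a, Φ, fun x y hxy => ?_, fun x => ⟨C x, hCB x, hC x, hΦ x⟩⟩
  by_contra hne
  have hex : ∃ n, x n ≠ y n := Function.ne_iff.1 hne
  classical
  let n := Nat.find hex
  have hn : x n ≠ y n := Nat.find_spec hex
  have hpre : initialValues x n = initialValues y n :=
    initialValues_congr fun m hm => by_contra fun h => Nat.find_min hex hm h
  let D := T (initialValues x n)
  have hlev : lev D < a := ha _ ⟨_, rfl⟩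
  -- At the first difference of `x` and `y`, their branches pass through the two disjoint nodes
  -- chosen for `D`.
  have hnode : ∀ z, T (initialValues z n) = D → A (lev D) (Φ z) = A (lev D) (node D (z n)) := by
    intro z hz
    refine hA.eq_of_inter_infinite le_rfl ((hC z).not_finite_inter (hΦ z _ hlev) ?_)
    refine (hCT z (n + 1)).subset (sdiff_subset_sdiff_right ?_)
    change next (T (initialValues z n)) (z n) ⊆ _
    rw [hz]
    exact hnA D (z n)
  have h1 := hnode x rfl
  have h2 := hnode y (by rw [← hpre])
  have h3 : A (lev D) (Φ x) = A (lev D) (Φ y) :=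
    hA.congr _ _ _ fun b hb => hxy b (hb.trans_lt hlev)
  have hd := hnd D _ _ hn
  rw [← h1, ← h2, h3, disjoint_self] at hd
  exact (hA.infinite (lev D) (Φ y)).nonempty.ne_empty hd

/-- There are no wild sets. -/
theorem not_isWild (hA : IsSplittingTree S A)
    (hI : ∀ a : I, HasChainPseudointersections (Iio a)) (hω : HasChainPseudointersections ℕ)
    (hcof : ∀ s : Set I, s.Countable → ∃ a, ∀ b ∈ s, b < a)
    (hS : ∀ B : Set ℕ, B.Infinite → ∃ a, (B ∩ S a).Infinite ∧ (B \ S a).Infinite)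
    (B : Set ℕ) : ¬ IsWild A B := fun hB => by
  obtain ⟨a, Φ, hΦ, hΦB⟩ := hA.exists_continuum_branches hI hω hcof hS hB
  obtain ⟨f, C, hCB, hC, hCf, hCA⟩ := hA.kill a B Φ hΦ hΦB
  obtain ⟨b, g, h1, h2⟩ := hB.2 C hCB hC
  have hab : a ≤ b := le_of_not_gt fun hb => h2 (hA.not_split_of_lt hCf hb g h1)
  -- A node extending `f` is almost contained in its predecessor at level `a`, which misses `C`; any
  -- other node of level at least `a` is almost disjoint from `C`.
  by_cases hg : ∀ c < a, g c = f c
  · obtain ⟨x, hx⟩ := (hA.inter_infinite_of_le hab h1).nonempty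
    exact Set.disjoint_left.1 (hCA g hg) hx.1 hx.2
  · push Not at hg
    obtain ⟨c, hc, hne⟩ := hg
    refine h1 (((hCf c hc).union (hA.inter_finite (hc.le.trans hab) le_rfl hne)).subset
      fun x hx => ?_)
    by_cases hx' : x ∈ A c f
    · exact Or.inr ⟨hx.2, hx'⟩
    · exact Or.inl ⟨hx.1, hx'⟩

end IsSplittingTree

/-! ### Convergence of subsequences and convexity of cylinders. -/

/-- A sequence in `J → Bool` converges along an infinite set of indices on which each coordinate is
eventually constant. -/
theorem exists_subseq_tendsto {J : Type*} (x : ℕ → J → Bool) {N : Set ℕ} (hN : N.Infinite)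
    (h : ∀ j, {n ∈ N | x n j = true}.Finite ∨ {n ∈ N | x n j = false}.Finite) :
    ∃ a : J → Bool, ∃ φ : ℕ → ℕ, StrictMono φ ∧ Tendsto (x ∘ φ) atTop (𝓝 a) := by
  classical
  let φ : ℕ → ℕ := Nat.nth (· ∈ N)
  have hφ : StrictMono φ := Nat.nth_strictMono hN
  have hmem : ∀ n, φ n ∈ N := fun n => Nat.nth_mem_of_infinite hN n
  have hev : ∀ j i, {n ∈ N | x n j = i}.Finite → ∀ᶠ n in atTop, x (φ n) j = !i := by
    intro j i hfin
    have := (hfin.preimage hφ.injective.injOn)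
    rw [← Nat.cofinite_eq_atTop]
    filter_upwards [this.compl_mem_cofinite] with n hn
    by_contra hne
    exact hn ⟨hmem n, by simpa using hne⟩
  have hex : ∀ j, ∃ i, ∀ᶠ n in atTop, x (φ n) j = i := fun j =>
    (h j).elim (fun h => ⟨_, hev j _ h⟩) (fun h => ⟨_, hev j _ h⟩)
  choose a ha using hex
  refine ⟨a, φ, hφ, tendsto_pi_nhds.2 fun j => ?_⟩
  exact tendsto_nhds_of_eventually_eq (ha j)

/-- The lexicographic cylinders are convex. -/
theorem eq_of_lex_between {I : Type*} {X : Type*} [LinearOrder I] [WellFoundedLT I]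
    [LinearOrder X] {x y z : Lex (I → X)} (hxy : x ≤ y) (hyz : y ≤ z) {t : I → X} {a : I}
    (hx : ∀ b ≤ a, ofLex x b = t b) (hz : ∀ b ≤ a, ofLex z b = t b) :
    ∀ b ≤ a, ofLex y b = t b := by
  intro b
  induction b using WellFoundedLT.induction with
  | ind b ih =>
    intro hb
    have h1 := Pi.apply_le_of_toLex (x := ofLex x) (y := ofLex y) (i := b) hxy fun j hj => by
      rw [ih j hj (hj.le.trans hb), hx j (hj.le.trans hb)]
    have h2 := Pi.apply_le_of_toLex (x := ofLex y) (y := ofLex z) (i := b) hyz fun j hj => by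
      rw [ih j hj (hj.le.trans hb), hz j (hj.le.trans hb)]
    rw [hx b hb] at h1
    rw [hz b hb] at h2
    exact le_antisymm h2 h1

/-! ### The compactification determined by the tree. -/

namespace IsSplittingTree

variable {I : Type} {S : I → Set ℕ} {A : I → (I → Bool) → Set ℕ}

/-- The trace of the tree on a natural number. -/
noncomputable def trace (A : I → (I → Bool) → Set ℕ) (n : ℕ) (p : I × (I → Bool)) : Bool :=
  open Classical in decide (n ∈ A p.1 p.2)

theorem trace_eq_true {n : ℕ} {p : I × (I → Bool)} : trace A n p = true ↔ n ∈ A p.1 p.2 := by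
  simp [trace]

theorem trace_eq_false {n : ℕ} {p : I × (I → Bool)} : trace A n p = false ↔ n ∉ A p.1 p.2 := by
  simp [trace]

/-- The compactification of `ℕ` determined by the tree. -/
abbrev Compactification (A : I → (I → Bool) → Set ℕ) : Set (I × (I → Bool) → Bool) :=
  closure (range (trace A))

/-- Removing finitely many traces from a basic neighborhood of a remainder point leaves a
neighborhood. Two coordinates suffice to transfer relations modulo finite sets between pairs of
nodes to such points. -/
theorem infinite_trace_eq {x : I × (I → Bool) → Bool} (hx : x ∈ Compactification A)
    (hx' : x ∉ range (trace A)) (p q : I × (I → Bool)) :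
    {n | trace A n p = x p ∧ trace A n q = x q}.Infinite := by
  intro hfin
  let N := {n | trace A n p = x p ∧ trace A n q = x q}
  have hopen : IsOpen ({y | y p = x p ∧ y q = x q} ∩ (trace A '' N)ᶜ) := by
    refine IsOpen.inter ?_ (hfin.image _).isClosed.isOpen_compl
    exact ((isOpen_discrete {x p}).preimage (continuous_apply (A := fun _ => Bool) p)).inter
      ((isOpen_discrete {x q}).preimage (continuous_apply (A := fun _ => Bool) q))
  obtain ⟨_, ⟨h, h'⟩, n, rfl⟩ := mem_closure_iff.1 hx _ hopen
    ⟨⟨rfl, rfl⟩, fun ⟨n, _, hn⟩ => hx' ⟨n, hn⟩⟩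
  exact h' ⟨n, h, rfl⟩

/-- The branch of a point of the remainder. -/
noncomputable def branch (x : I × (I → Bool) → Bool) (a : I) : WithBot Bool :=
  -- The value `⊥` records that the branch ends before level `a`.
  open Classical in if h : ∃ f, x (a, f) = true then ((h.choose a : Bool) : WithBot Bool) else ⊥

/-- Either one natural number recurs infinitely often, giving a constant subsequence, or the
sequence of numbers is finite-to-one and its range has an infinite subset split by no node. -/
theorem exists_infinite_of_mem_range (hwild : ∀ B, ¬ IsWild A B)
    (x : ℕ → I × (I → Bool) → Bool) (hx : {n | x n ∈ range (trace A)}.Infinite) :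
    ∃ N : Set ℕ, N.Infinite ∧
      ∀ p, {n ∈ N | x n p = true}.Finite ∨ {n ∈ N | x n p = false}.Finite := by
  have hex : ∀ n, ∃ k, x n ∈ range (trace A) → trace A k = x n := fun n => by
    by_cases h : x n ∈ range (trace A)
    · obtain ⟨k, hk⟩ := h
      exact ⟨k, fun _ => hk⟩
    · exact ⟨0, fun h' => (h h').elim⟩
  choose k hk using hex
  let M := {n | x n ∈ range (trace A)}
  by_cases hfib : ∃ m, {n ∈ M | k n = m}.Infinite
  · obtain ⟨m, hm⟩ := hfib
    refine ⟨_, hm, fun p => ?_⟩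
    have hxp : ∀ n ∈ {n ∈ M | k n = m}, x n p = trace A m p := fun n hn => by
      rw [← hk n hn.1, hn.2]
    cases h : trace A m p
    · left
      convert finite_empty
      refine eq_empty_of_forall_notMem fun n hn => ?_
      have := (hxp n hn.1).symm.trans hn.2
      simp [h] at this
    · right
      convert finite_empty
      refine eq_empty_of_forall_notMem fun n hn => ?_
      have := (hxp n hn.1).symm.trans hn.2
      simp [h] at this
  · push Not at hfib
    have hpre : ∀ s : Set ℕ, s.Finite → {n ∈ M | k n ∈ s}.Finite := fun s hs => by
      refine (hs.biUnion fun m _ => hfib m).subset fun n hn => ?_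
      exact mem_biUnion hn.2 ⟨hn.1, rfl⟩
    have hB : (k '' M).Infinite := fun h =>
      hx ((hpre _ h).subset fun n hn => ⟨hn, n, hn, rfl⟩)
    obtain ⟨C, hCB, hC, hCA⟩ : ∃ C ⊆ k '' M, C.Infinite ∧
        ∀ a f, (C ∩ A a f).Infinite → (C \ A a f).Finite := by
      by_contra hcon
      push Not at hcon
      exact hwild _ ⟨hB, hcon⟩
    refine ⟨{n ∈ M | k n ∈ C}, fun h => hC ((h.image k).subset fun c hc => ?_), fun p => ?_⟩
    · obtain ⟨n, hn, rfl⟩ := hCB hc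
      exact ⟨n, ⟨hn, hc⟩, rfl⟩
    · by_cases hp : (C ∩ A p.1 p.2).Finite
      · left
        refine (hpre _ hp).subset ?_
        rintro n ⟨⟨hn, hnC⟩, h⟩
        rw [← hk n hn, trace_eq_true] at h
        exact ⟨hn, hnC, h⟩
      · right
        refine (hpre _ (hCA _ _ hp)).subset ?_
        rintro n ⟨⟨hn, hnC⟩, h⟩
        rw [← hk n hn, trace_eq_false] at h
        exact ⟨hn, hnC, h⟩

variable [LinearOrder I]

theorem eq_true_iff_branch (hA : IsSplittingTree S A) [WellFoundedLT I]
    {x : I × (I → Bool) → Bool} (hx : x ∈ Compactification A) (hx' : x ∉ range (trace A)) (a : I)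
    (f : I → Bool) : x (a, f) = true ↔ ∀ b ≤ a, branch x b = (f b : WithBot Bool) := by
  have hdown : ∀ a b f, b ≤ a → x (a, f) = true → x (b, f) = true := by
    intro a b f hb h
    by_contra hne
    rw [Bool.not_eq_true] at hne
    refine infinite_trace_eq hx hx' (a, f) (b, f) ((hA.diff_finite a b f hb).subset fun n hn => ?_)
    rw [mem_ofPred_eq, h, hne, trace_eq_true, trace_eq_false] at hn
    exact hn
  have hcoh : ∀ a f g, x (a, f) = true → x (a, g) = true → ∀ b ≤ a, f b = g b := by
    intro a f g h h' b hb
    by_contra hne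
    refine infinite_trace_eq hx hx' (a, f) (a, g) ((hA.inter_finite hb hb hne).subset fun n hn => ?_)
    rw [mem_ofPred_eq, h, h', trace_eq_true, trace_eq_true] at hn
    exact hn
  have hcongr : ∀ a f g, (∀ b ≤ a, f b = g b) → x (a, f) = true → x (a, g) = true := by
    intro a f g hfg h
    obtain ⟨n, h1, h2⟩ := (infinite_trace_eq hx hx' (a, f) (a, g)).nonempty
    rw [← h2, trace_eq_true, ← hA.congr a f g hfg]
    rwa [h, trace_eq_true] at h1
  have hmp : ∀ a f, x (a, f) = true → ∀ b ≤ a, branch x b = (f b : WithBot Bool) := by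
    intro a f h b hb
    have hex : ∃ g, x (b, g) = true := ⟨f, hdown a b f hb h⟩
    rw [branch, dif_pos hex, hcoh b _ f hex.choose_spec (hdown a b f hb h) b le_rfl]
  refine ⟨hmp a f, fun h => ?_⟩
  have hex : ∃ g, x (a, g) = true := by
    by_contra hex
    have := h a le_rfl
    rw [branch, dif_neg hex] at this
    exact WithBot.bot_ne_coe this
  obtain ⟨g, hg⟩ := hex
  refine hcongr a g f (fun b hb => ?_) hg
  exact WithBot.coe_injective ((hmp a g hg b hb).symm.trans (h b hb))

/-- Along a lexicographically monotone subsequence, the indices at which a given coordinate is true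
form an interval of ℕ, hence a finite or cofinite set. -/
theorem exists_infinite_of_not_mem_range (hA : IsSplittingTree S A) [WellFoundedLT I]
    (x : ℕ → I × (I → Bool) → Bool) (hx : ∀ n, x n ∈ Compactification A)
    (hx' : {n | x n ∉ range (trace A)}.Infinite) :
    ∃ N : Set ℕ, N.Infinite ∧
      ∀ p, {n ∈ N | x n p = true}.Finite ∨ {n ∈ N | x n p = false}.Finite := by
  classical
  let ψ : ℕ → ℕ := Nat.nth (· ∈ {n | x n ∉ range (trace A)})
  have hψ : StrictMono ψ := Nat.nth_strictMono hx'
  have hψmem : ∀ n, x (ψ n) ∉ range (trace A) := fun n => Nat.nth_mem_of_infinite hx' n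
  let ℓ : ℕ → Lex (I → WithBot Bool) := fun n => toLex (branch (x (ψ n)))
  have hmem : ∀ n a f, x (ψ n) (a, f) = true ↔ ∀ b ≤ a, ofLex (ℓ n) b = (f b : WithBot Bool) :=
    fun n a f => hA.eq_true_iff_branch (hx _) (hψmem n) a f
  obtain ⟨g, hg⟩ := exists_increasing_or_nonincreasing_subseq (· ≤ ·) ℓ
  have hconv : ∀ k m n p, k ≤ m → m ≤ n → x (ψ (g k)) p = true → x (ψ (g n)) p = true →
      x (ψ (g m)) p = true := by
    rintro k m n ⟨a, f⟩ hkm hmn hk hn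
    rw [hmem] at hk hn ⊢
    rcases hg with hg | hg
    · have hmono : Monotone (ℓ ∘ g) := fun i j hij => by
        rcases hij.eq_or_lt with rfl | hij
        · exact le_rfl
        · exact hg i j hij
      exact eq_of_lex_between (hmono hkm) (hmono hmn) hk hn
    · have hanti : Antitone (ℓ ∘ g) := fun i j hij => by
        rcases hij.eq_or_lt with rfl | hij
        · exact le_rfl
        · exact (not_le.1 (hg i j hij)).le
      exact eq_of_lex_between (hanti hmn) (hanti hkm) hn hk
  have hinj : Function.Injective (ψ ∘ g) := hψ.injective.comp g.injective
  refine ⟨range (ψ ∘ g), infinite_range_of_injective hinj, fun p => ?_⟩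
  by_cases hfin : {m | x (ψ (g m)) p = true}.Finite
  · left
    refine (hfin.image (ψ ∘ g)).subset ?_
    rintro _ ⟨⟨m, rfl⟩, hm⟩
    exact ⟨m, hm, rfl⟩
  · right
    obtain ⟨k, hk⟩ := Set.Infinite.nonempty hfin
    refine ((finite_lt_nat k).image (ψ ∘ g)).subset ?_
    rintro _ ⟨⟨m, rfl⟩, hm⟩
    refine ⟨m, mem_ofPred.2 (lt_of_not_ge fun hkm => ?_), rfl⟩
    obtain ⟨n, hn, hmn⟩ := Set.Infinite.exists_gt hfin m
    exact Bool.noConfusion ((hconv k m n p hkm hmn.le hk hn).symm.trans hm)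

theorem seqCompactSpace (hA : IsSplittingTree S A) [WellFoundedLT I] (hwild : ∀ B, ¬ IsWild A B) :
    SeqCompactSpace (Compactification A) := by
  refine isSeqCompact_iff_seqCompactSpace.1 fun x hx => ?_
  obtain ⟨N, hN, hNx⟩ : ∃ N : Set ℕ, N.Infinite ∧
      ∀ p, {n ∈ N | x n p = true}.Finite ∨ {n ∈ N | x n p = false}.Finite := by
    by_cases h : {n | x n ∈ range (trace A)}.Infinite
    · exact exists_infinite_of_mem_range hwild x h
    · exact hA.exists_infinite_of_not_mem_range x hx (not_infinite.1 h).infinite_compl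
  obtain ⟨a, φ, hφ, ha⟩ := exists_subseq_tendsto x hN hNx
  exact ⟨a, isClosed_closure.mem_of_tendsto ha (Eventually.of_forall fun n => hx _), φ, hφ, ha⟩

/-- Every branch of the tree determines a point of the remainder. -/
theorem mk_le (hA : IsSplittingTree S A) [WellFoundedLT I] [Nonempty I] :
    #(I → Bool) ≤ #(Compactification A) := by
  have hex : ∀ f : I → Bool, ∃ x ∈ Compactification A, (∀ a, x (a, f) = true) ∧
      ∀ a g, f a ≠ g a → x (a, g) = false := by
    intro f
    -- An ultrafilter containing the cofinite sets and all nodes along `f` defines the point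
    -- belonging to `f`.
    let G : I → Filter ℕ := fun a => cofinite ⊓ 𝓟 (A a f)
    have hanti : Antitone G := fun b a hb => by
      refine le_inf inf_le_left (le_principal_iff.2 ?_)
      refine mem_inf_of_inter (hA.diff_finite a b f hb).compl_mem_cofinite
        (mem_principal_self (A a f)) fun n hn => ?_
      by_contra h
      exact hn.1 ⟨hn.2, h⟩
    have hne : ∀ a, (G a).NeBot := fun a => by
      rw [cofinite_inf_principal_neBot_iff]
      exact hA.infinite a f
    have : (⨅ a, G a).NeBot := iInf_neBot_of_directed hanti.directed_ge hne
    let U : Ultrafilter ℕ := Ultrafilter.of (⨅ a, G a)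
    have hU : ∀ a, (U : Filter ℕ) ≤ G a := fun a => (Ultrafilter.of_le _).trans (iInf_le _ a)
    have hUA : ∀ a, A a f ∈ U := fun a => (hU a) (mem_inf_of_right (mem_principal_self _))
    classical
    refine ⟨fun p => decide (A p.1 p.2 ∈ U), ?_, fun a => by simpa using hUA a,
      fun a g hg => ?_⟩
    · refine mem_closure_of_tendsto (f := trace A) (b := (U : Filter ℕ)) (tendsto_pi_nhds.2
        fun p => tendsto_nhds_of_eventually_eq ?_) (Eventually.of_forall fun n => ⟨n, rfl⟩)
      by_cases hp : A p.1 p.2 ∈ U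
      · filter_upwards [hp] with n hn
        simp [trace, hn, hp]
      · filter_upwards [Ultrafilter.compl_mem_iff_notMem.2 hp] with n hn
        simp only [trace, hp, decide_false, decide_eq_false_iff_not]
        exact hn
    · refine decide_eq_false fun h => ?_
      have hc := (hU a) (mem_inf_of_left
        (hA.inter_finite le_rfl le_rfl hg).compl_mem_cofinite)
      exact U.empty_notMem (by simpa using inter_mem hc (inter_mem (hUA a) h))
  choose x hxm hx1 hx2 using hex
  refine mk_le_of_injective (f := fun f => (⟨x f, hxm f⟩ : Compactification A)) fun f g hfg => ?_
  by_contra hne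
  obtain ⟨a, ha⟩ := Function.ne_iff.1 hne
  have h1 := hx1 g a
  have h2 : x f = x g := congrArg Subtype.val hfg
  rw [← h2, hx2 f a g ha] at h1
  exact Bool.noConfusion h1

end IsSplittingTree

/-! ### Separability, and the case without a splitting family. -/

/-- A power of `Bool` with at most continuum many factors is separable. -/
theorem separableSpace_pi_bool {I : Type} (hI : #I ≤ continuum) :
    TopologicalSpace.SeparableSpace (I → Bool) := by
  classical
  obtain ⟨ι⟩ : Nonempty (I ↪ (ℕ → Bool)) := by
    rw [← Cardinal.le_def]
    simpa using hI
  have : Countable (TopologicalSpace.Clopens (ℕ → Bool)) :=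
    TopologicalSpace.Clopens.countable_iff_secondCountable.2 inferInstance
  -- Indices are placed in Cantor space; its countably many clopen sets separate any two disjoint
  -- finite sets, so their indicators realize every finite pattern.
  let d : TopologicalSpace.Clopens (ℕ → Bool) → I → Bool := fun K i => decide (ι i ∈ K)
  refine ⟨range d, countable_range d, fun x => mem_closure_iff_nhds.2 fun U hU => ?_⟩
  obtain ⟨s, hs⟩ : ∃ s : Finset I, ∀ y : I → Bool, (∀ i ∈ s, y i = x i) → y ∈ U := by
    rw [nhds_pi, Filter.mem_pi] at hU
    obtain ⟨t, ht, V, hV, hVU⟩ := hU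
    refine ⟨ht.toFinset, fun y hy => hVU fun i hi => ?_⟩
    rw [hy i (ht.mem_toFinset.2 hi)]
    exact mem_of_mem_nhds (hV i)
  obtain ⟨K, hK, h1, h2⟩ := exists_clopen_of_closed_subset_open
    (Z := ι '' {i | i ∈ s ∧ x i = true}) (U := (ι '' {i | i ∈ s ∧ x i = false})ᶜ)
    (((s.finite_toSet.subset fun i hi => hi.1).image ι).isClosed)
    (((s.finite_toSet.subset fun i hi => hi.1).image ι).isClosed.isOpen_compl)
    (by
      rintro _ ⟨i, hi, rfl⟩ ⟨j, hj, hij⟩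
      have := ι.injective hij
      subst this
      simp [hi.2] at hj)
  refine ⟨d ⟨K, hK⟩, hs _ fun i hi => ?_, ⟨_, rfl⟩⟩
  cases h : x i
  · exact decide_eq_false fun hmem => h2 hmem ⟨i, ⟨hi, h⟩, rfl⟩
  · exact decide_eq_true (h1 ⟨i, ⟨hi, h⟩, rfl⟩)

theorem separableSpace_closure_range {X : Type*} [TopologicalSpace X] (u : ℕ → X) :
    TopologicalSpace.SeparableSpace (closure (range u)) := by
  refine ⟨range fun n => (⟨u n, subset_closure ⟨n, rfl⟩⟩ : closure (range u)),
    countable_range _, Subtype.dense_iff.2 ?_⟩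
  rw [← range_comp]
  exact Subset.rfl

/-- If no family of sets indexed by `I` is splitting, then `I → Bool` is sequentially compact. -/
theorem seqCompactSpace_pi_bool {I : Type}
    (h : ∀ S : I → Set ℕ, ∃ B : Set ℕ, B.Infinite ∧
      ∀ a, (B ∩ S a).Finite ∨ (B \ S a).Finite) : SeqCompactSpace (I → Bool) := by
  refine ⟨fun x _ => ?_⟩
  obtain ⟨B, hB, hBS⟩ := h fun a => {n | x n a = true}
  obtain ⟨a, φ, hφ, ha⟩ := exists_subseq_tendsto x hB fun a =>
    (hBS a).imp id fun h => h.subset fun n hn => ⟨hn.1, fun h' => by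
      have := h'.symm.trans hn.2
      simp at this⟩
  exact ⟨a, mem_univ _, φ, hφ, ha⟩

/-! ### The choice of κ and the dichotomy. -/

/-- If `κ` is minimal with `2 ^ κ > 𝔠`, then countable subsets of a well-order of type `κ` are
bounded. -/
theorem exists_gt_of_countable {I : Type} [LinearOrder I]
    (hI : continuum < (2 : Cardinal.{0}) ^ #I)
    (hlt : ∀ a : I, (2 : Cardinal.{0}) ^ #(Iic a) ≤ continuum) (s : Set I) (hs : s.Countable) :
    ∃ a, ∀ b ∈ s, b < a := by
  by_contra hcon
  push Not at hcon
  have : Countable s := hs.to_subtype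
  -- Restrictions to the segments up to an unbounded countable set determine a function, so 2^κ
  -- would be at most 𝔠^ω = 𝔠.
  let r : (I → Bool) → ∀ b : s, Iic (b : I) → Bool := fun f b c => f c
  have hr : Function.Injective r := fun f g hfg => by
    funext a
    obtain ⟨b, hb, hab⟩ := hcon a
    exact congrFun (congrFun hfg ⟨b, hb⟩) ⟨a, hab⟩
  have h1 : #(I → Bool) ≤ continuum := by
    refine (mk_le_of_injective hr).trans ?_
    rw [mk_pi]
    calc Cardinal.prod (fun b : s => #(Iic (b : I) → Bool))
        ≤ Cardinal.prod (fun _ : s => continuum) := Cardinal.prod_le_prod _ _ fun b => by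
          simpa using hlt b
      _ = continuum ^ #s := by simp
      _ ≤ continuum ^ aleph0 := Cardinal.power_le_power_left continuum_ne_zero (mk_le_aleph0)
      _ = continuum := continuum_power_aleph0
  exact hI.not_ge (by simpa using h1)

theorem exists_large_separable_seqCompact
    (h : continuum < (2 : Cardinal.{0}) ^ pseudointersectionNumber) :
    ∃ (X : Type) (_ : TopologicalSpace X), CompactSpace X ∧ T2Space X ∧
      TopologicalSpace.SeparableSpace X ∧ SeqCompactSpace X ∧ continuum < #X := by
  let κ : Cardinal.{0} := sInf {κ | continuum < (2 : Cardinal.{0}) ^ κ}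
  have hκ : continuum < (2 : Cardinal.{0}) ^ κ :=
    csInf_mem (s := {κ : Cardinal.{0} | continuum < (2 : Cardinal.{0}) ^ κ}) ⟨_, h⟩
  have hmin : ∀ μ < κ, (2 : Cardinal.{0}) ^ μ ≤ continuum := fun μ hμ =>
    le_of_not_gt fun h' => (notMem_of_lt_csInf' hμ) h'
  have hκc : κ ≤ continuum := csInf_le' (cantor continuum)
  have hκp : HasPseudointersectionsBelow κ :=
    hasPseudointersectionsBelow_of_le (csInf_le' h)
  have hκω : aleph0 < κ := by
    by_contra hle
    refine hκ.not_ge ((Cardinal.power_le_power_left two_ne_zero (not_lt.1 hle)).trans ?_)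
    rw [two_power_aleph0]
  let I := κ.ord.ToType
  have hI : #I = κ := by simp [I]
  have hbool : #(I → Bool) = 2 ^ κ := by simp [I]
  have htype : (#I).ord = Ordinal.type (α := I) (· < ·) := by simp [I]
  -- The dichotomy is whether some family of κ sets is splitting.
  by_cases hS : ∃ S : I → Set ℕ, ∀ B : Set ℕ, B.Infinite →
      ∃ a, (B ∩ S a).Infinite ∧ (B \ S a).Infinite
  · obtain ⟨S, hS⟩ := hS
    have hps : ∀ a : I, HasChainPseudointersections (Iio a) := fun a =>
      hκp.hasChainPseudointersections ((mk_Iio_lt a htype).trans_eq hI)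
    have hω : HasChainPseudointersections ℕ := hκp.hasChainPseudointersections (by simpa using hκω)
    have hcof : ∀ s : Set I, s.Countable → ∃ a, ∀ b ∈ s, b < a :=
      exists_gt_of_countable (hI.symm ▸ hκ) fun a =>
        hmin _ ((mk_Iic_lt a htype (hI.symm ▸ hκω.le)).trans_eq hI)
    have : Nonempty I := (hcof ∅ countable_empty).nonempty
    obtain ⟨A, hA⟩ := exists_isSplittingTree hps S
    refine ⟨IsSplittingTree.Compactification A, inferInstance,
      isCompact_iff_compactSpace.1 isClosed_closure.isCompact, inferInstance,
      separableSpace_closure_range _, hA.seqCompactSpace (hA.not_isWild hps hω hcof hS), ?_⟩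
    exact (hbool ▸ hκ).trans_le hA.mk_le
  · push Not at hS
    refine ⟨I → Bool, inferInstance, inferInstance, inferInstance,
      separableSpace_pi_bool (hI ▸ hκc), seqCompactSpace_pi_bool fun S => ?_, hbool ▸ hκ⟩
    obtain ⟨B, hB, hBS⟩ := hS S
    exact ⟨B, hB, fun a => or_iff_not_imp_left.2 fun h => not_infinite.1 fun h' => by
      have := hBS a h
      exact h' (by simpa using this)⟩

/-! ### Martin's Axiom implies 𝔠 ≤ 𝔭. -/

/-- A condition of Mathias forcing for the family `F`: a finite stem, and finitely many members of
`F` that contain all later elements of the generic set. -/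
structure MathiasCondition (F : Set (Set ℕ)) where
  stem : Finset ℕ
  side : Finset F

namespace MathiasCondition

variable {F : Set (Set ℕ)}

instance : PartialOrder (MathiasCondition F) where
  le p q := q.stem ⊆ p.stem ∧ q.side ⊆ p.side ∧
    ∀ k ∈ p.stem, k ∉ q.stem → ∀ B ∈ q.side, k ∈ (B : Set ℕ)
  le_refl p := ⟨Finset.Subset.refl _, Finset.Subset.refl _, fun _ h h' => (h' h).elim⟩
  le_trans p q r hpq hqr := ⟨hqr.1.trans hpq.1, hqr.2.1.trans hpq.2.1, fun k hk hkr B hB => by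
    by_cases hkq : k ∈ q.stem
    · exact hqr.2.2 k hkq hkr B hB
    · exact hpq.2.2 k hk hkq B (hqr.2.1 hB)⟩
  le_antisymm p q hpq hqp := by
    cases p
    cases q
    simp only [mk.injEq]
    exact ⟨hqp.1.antisymm hpq.1, hqp.2.1.antisymm hpq.2.1⟩

theorem le_def {p q : MathiasCondition F} : p ≤ q ↔ q.stem ⊆ p.stem ∧ q.side ⊆ p.side ∧
    ∀ k ∈ p.stem, k ∉ q.stem → ∀ B ∈ q.side, k ∈ (B : Set ℕ) := Iff.rfl

instance : Nonempty (MathiasCondition F) := ⟨⟨∅, ∅⟩⟩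

/-- Conditions with equal stems are compatible through the union of their sides, and there are only
countably many stems. -/
theorem forcingCCC : ForcingCCC (MathiasCondition F) := by
  classical
  intro A hA
  refine countable_iff_exists_injOn.2 ?_
  obtain ⟨e, he⟩ := exists_injective_nat (Finset ℕ)
  refine ⟨fun p => e p.stem, fun p hp q hq hpq => ?_⟩
  by_contra hne
  have hst : p.stem = q.stem := he hpq
  have hp' : (⟨p.stem, p.side ∪ q.side⟩ : MathiasCondition F) ≤ p :=
    le_def.2 ⟨Finset.Subset.refl _, Finset.subset_union_left, fun _ h h' => (h' h).elim⟩
  have hq' : (⟨p.stem, p.side ∪ q.side⟩ : MathiasCondition F) ≤ q :=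
    le_def.2 ⟨hst ▸ Finset.Subset.refl _, Finset.subset_union_right,
      fun _ h h' => (h' (hst ▸ h)).elim⟩
  exact (hA hp hq hne _).elim (fun h => h hp') (fun h => h hq')

theorem forcingDense_side (B : F) : ForcingDense {p : MathiasCondition F | B ∈ p.side} := by
  classical
  exact fun p => ⟨⟨p.stem, insert B p.side⟩, Finset.mem_insert_self _ _,
    le_def.2 ⟨Finset.Subset.refl _, Finset.subset_insert _ _, fun _ h h' => (h' h).elim⟩⟩

theorem forcingDense_stem (hF : IsCenteredFamily F) (n : ℕ) :
    ForcingDense {p : MathiasCondition F | ∃ k ∈ p.stem, n < k} := by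
  classical
  intro p
  obtain ⟨k, hk, hnk⟩ := (hF (Subtype.val '' (p.side : Set F)) (by rintro _ ⟨B, -, rfl⟩; exact B.2)
    (p.side.finite_toSet.image _)).exists_gt n
  refine ⟨⟨insert k p.stem, p.side⟩, ⟨k, Finset.mem_insert_self _ _, hnk⟩,
    le_def.2 ⟨Finset.subset_insert _ _, Finset.Subset.refl _, fun j hj hjp B hB => ?_⟩⟩
  rw [(Finset.mem_insert.1 hj).resolve_right hjp]
  exact hk B ⟨B, hB, rfl⟩

end MathiasCondition

theorem MartinsAxiom.continuum_le (h : MartinsAxiom) : continuum ≤ pseudointersectionNumber := by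
  refine le_csInf pseudointersectionCardinals_nonempty ?_
  rintro _ ⟨F, hF, hA, rfl⟩
  by_contra hlt
  rw [not_le] at hlt
  refine hA ?_
  obtain ⟨G, hG⟩ := h (MathiasCondition F) MathiasCondition.forcingCCC
    (range (fun B : F => {p : MathiasCondition F | B ∈ p.side}) ∪
      range fun n : ℕ => {p : MathiasCondition F | ∃ k ∈ p.stem, n < k})
    ((mk_union_le _ _).trans_lt (add_lt_of_lt aleph0_le_continuum (mk_range_le.trans_lt hlt)
      (mk_range_le.trans_lt (by simpa using aleph0_lt_continuum))))
    (by
      rintro _ (⟨B, rfl⟩ | ⟨n, rfl⟩)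
      · exact MathiasCondition.forcingDense_side B
      · exact MathiasCondition.forcingDense_stem hF n)
  -- The union of the generic stems. Once `B` is in the side of some `p` in `G`, elements outside
  -- the stem of `p` must belong to `B`.
  refine ⟨{k | ∃ p ∈ G, k ∈ p.stem}, infinite_of_forall_exists_gt fun n => ?_, fun B hB => ?_⟩
  · obtain ⟨p, hp, k, hk, hnk⟩ := hG _ (Or.inr ⟨n, rfl⟩)
    exact ⟨k, ⟨p, hp, hk⟩, hnk⟩
  · obtain ⟨p, hp, hpB⟩ := hG _ (Or.inl ⟨⟨B, hB⟩, rfl⟩)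
    refine p.stem.finite_toSet.subset ?_
    rintro k ⟨⟨q, hq, hkq⟩, hkB⟩
    obtain ⟨r, -, hrp, hrq⟩ := G.directed p hp q hq
    by_contra hkp
    exact hkB ((MathiasCondition.le_def.1 hrp).2.2 k ((MathiasCondition.le_def.1 hrq).1 hkq) hkp
      ⟨B, hB⟩ hpB)

theorem mainTheorem4 :
    (Cardinal.continuum < 2 ^ pseudointersectionNumber →
      ∃ (X : Type) (_ : TopologicalSpace X), CompactSpace X ∧ T2Space X ∧
        TopologicalSpace.SeparableSpace X ∧ SeqCompactSpace X ∧
        Cardinal.continuum < Cardinal.mk X) ∧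
    (pseudointersectionNumber = Cardinal.continuum →
      ∃ (X : Type) (_ : TopologicalSpace X), CompactSpace X ∧ T2Space X ∧
        TopologicalSpace.SeparableSpace X ∧ SeqCompactSpace X ∧
        Cardinal.continuum < Cardinal.mk X) ∧
    (MartinsAxiom →
      ∃ (X : Type) (_ : TopologicalSpace X), CompactSpace X ∧ T2Space X ∧
        TopologicalSpace.SeparableSpace X ∧ SeqCompactSpace X ∧
        Cardinal.continuum < Cardinal.mk X) := by
  have key : Cardinal.continuum ≤ pseudointersectionNumber →
      Cardinal.continuum < (2 : Cardinal.{0}) ^ pseudointersectionNumber := fun h =>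
    (Cardinal.cantor _).trans_le (Cardinal.power_le_power_left two_ne_zero h)
  exact ⟨exists_large_separable_seqCompact,
    fun h => exists_large_separable_seqCompact (key h.ge),
    fun h => exists_large_separable_seqCompact (key h.continuum_le)⟩
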